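/- Let $G=(V,E)$ be a finite connected simple graph with at least one edge, let $\Bbbk$ be a field, let $S=\Bbbk[V]$ be the polynomial ring whose variables are the vertices of $G$, and let $I(G)=\langle xy : \{x,y\}\in E\rangle\subseteq S$ be the edge ideal of $G$. For a monomial ideal $I\subseteq S$ let $\mathrm{Mingens}(I)$ be its set of minimal monomial generators. Given a strict total order $\succ$ on $\mathrm{Mingens}(I)$, a subset $\sigma=\{m_1\succ\cdots\succ m_k\}$ of $\mathrm{Mingens}(I)$ is called Lyubeznik-critical if there are no $m\in\mathrm{Mingens}(I)$ and $1<t\le k$ with $m_t\succ m$ and $m\mid\operatorname{lcm}(m_1,\dots,m_t)$. The Lyubeznik resolution of $S/I$ with respect to $\succ$ is the subcomplex of the Taylor resolution whose module in homological degree $i$ is the free $S$-module on the Lyubeznik-critical sets with exactly $i$ elements, with differential $$\partial(\sigma)=\sum_{j=1}^{k}(-1)^{j-1}\,\frac{\operatorname{lcm}(\sigma)}{\operatorname{lcm}(\sigma\setminus\{m_j\})}\;\sigma\setminus\{m_j\}.$$ A free resolution $(F_\bullet,\partial)$ is minimal if $\partial(F_i)\subseteq \mathfrak m F_{i-1}$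 for all $i\ge 1$, where $\mathfrak m$ is the ideal generated by the variables. We say that $I$ has a minimal Lyubeznik resolution if, for some total order $\succ$ on $\mathrm{Mingens}(I)$, the Lyubeznik resolution of $S/I$ with respect to $\succ$ is a minimal free resolution of $S/I$. Then, for every integer $n\ge 2$, the ideal $I(G)^n$ has a minimal Lyubeznik resolution if and only if one of the following holds: 1. $G$ is a single edge (i.e. $G\cong P_2$, the path on $2$ vertices); or 2. $n=2$ and $G$ is a path of length $2$ (i.e. $G\cong P_3$, the path on $3$ vertices). -/

import Mathlib

/-- The edge ideal `I(G) = ⟨x y : {x, y} ∈ E(G)⟩` in the polynomial ring `𝕜[V]`. -/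
noncomputable def edgeIdeal {V : Type*} (𝕜 : Type*) [Field 𝕜] (G : SimpleGraph V) :
    Ideal (MvPolynomial V 𝕜) :=
  Ideal.span {p | ∃ x y : V, G.Adj x y ∧ p = MvPolynomial.X x * MvPolynomial.X y}

/-- The minimal monomial generators of a monomial ideal `I`: the monomials of `I` that are minimal
for divisibility. A monomial is recorded by its exponent vector, so that divisibility is `≤` and
the least common multiple is `⊔`. -/
abbrev Mingens {V 𝕜 : Type*} [Field 𝕜] (I : Ideal (MvPolynomial V 𝕜)) : Type _ :=
  {a : V →₀ ℕ // Minimal (fun b : V →₀ ℕ => MvPolynomial.monomial b (1 : 𝕜) ∈ I) a}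

namespace Lyubeznik

variable {V 𝕜 : Type*} [Field 𝕜] {I : Ideal (MvPolynomial V 𝕜)}

/-- The least common multiple of a finite set of minimal generators (`1` for the empty set). -/
noncomputable def lcmOf (σ : Finset (Mingens I)) : V →₀ ℕ :=
  σ.sup (fun a => a.1)

open scoped Classical in
/-- For a strict total order `r` on the minimal generators (`r a b` is read `a ≻ b`), the set
`σ = {m₁ ≻ ⋯ ≻ m_k}` is Lyubeznik-critical if there is no minimal generator `m` that divides
`lcm (m₁, …, m_t)` for some `1 < t ≤ k` with `m_t ≻ m`. Below `p` is `m_t`, and `1 < t` says that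
some `q ∈ σ` satisfies `q ≻ p`. -/
def IsCritical (r : Mingens I → Mingens I → Prop) (σ : Finset (Mingens I)) : Prop :=
  ¬ ∃ m : Mingens I, ∃ p ∈ σ, (∃ q ∈ σ, r q p) ∧ r p m ∧
    m.1 ≤ lcmOf (σ.filter (fun q => q = p ∨ r q p))

theorem IsCritical.mono {r : Mingens I → Mingens I → Prop} {σ τ : Finset (Mingens I)}
    (hσ : IsCritical r σ) (h : τ ⊆ σ) : IsCritical r τ := by
  classical
  rintro ⟨m, p, hp, ⟨q, hq, hqp⟩, hpm, hm⟩
  exact hσ ⟨m, p, h hp, ⟨q, h hq, hqp⟩, hpm,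
    hm.trans (Finset.sup_mono (Finset.filter_subset_filter _ h))⟩

/-- The Lyubeznik-critical sets with exactly `i` elements. -/
abbrev Crit (r : Mingens I → Mingens I → Prop) (i : ℕ) : Type _ :=
  {σ : Finset (Mingens I) // IsCritical r σ ∧ σ.card = i}

/-- The free module in homological degree `i` of the Lyubeznik resolution: its basis is the
collection of Lyubeznik-critical sets with `i` elements. -/
abbrev Chain (r : Mingens I → Mingens I → Prop) (i : ℕ) : Type _ :=
  Crit r i →₀ MvPolynomial V 𝕜

open scoped Classical in
/-- The facet `σ \ {a}` of a critical set `σ`. -/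
noncomputable def facet {r : Mingens I → Mingens I → Prop} {i : ℕ} (σ : Crit r (i + 1))
    (a : Mingens I) (ha : a ∈ σ.1) : Crit r i :=
  ⟨σ.1.erase a, σ.2.1.mono (Finset.erase_subset _ _), by
    rw [Finset.card_erase_of_mem ha, σ.2.2, Nat.add_sub_cancel]⟩

open scoped Classical in
/-- The differential of the Lyubeznik resolution, which is that of the Taylor resolution restricted
to critical sets: for `σ = {m₁ ≻ ⋯ ≻ m_k}`,
`∂ σ = ∑ j, (-1) ^ (j - 1) * (lcm σ / lcm (σ \ {m_j})) • (σ \ {m_j})`. -/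
noncomputable def diff (r : Mingens I → Mingens I → Prop) (i : ℕ) :
    Chain r (i + 1) →ₗ[MvPolynomial V 𝕜] Chain r i :=
  Finsupp.linearCombination (MvPolynomial V 𝕜) fun σ : Crit r (i + 1) =>
    ∑ a ∈ σ.1.attach,
      Finsupp.single (facet σ a.1 a.2)
        ((-1 : MvPolynomial V 𝕜) ^ (σ.1.filter (fun b => r b a.1)).card *
          MvPolynomial.monomial (lcmOf σ.1 - lcmOf (facet σ a.1 a.2).1) 1)

/-- The augmentation `F₀ = S → S / I`, which sends the basis element `∅` to the class of `1`. -/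
noncomputable def aug (r : Mingens I → Mingens I → Prop) :
    Chain r 0 →ₗ[MvPolynomial V 𝕜] (MvPolynomial V 𝕜 ⧸ I) :=
  Finsupp.linearCombination (MvPolynomial V 𝕜) fun _ => (1 : MvPolynomial V 𝕜 ⧸ I)

end Lyubeznik

/-- `⋯ → F₂ → F₁ → F₀ → M → 0` is a free resolution of `M`. -/
structure IsFreeResolution {S : Type*} [CommRing S] {F : ℕ → Type*} [∀ i, AddCommGroup (F i)]
    [∀ i, Module S (F i)] {M : Type*} [AddCommGroup M] [Module S M]
    (d : ∀ i, F (i + 1) →ₗ[S] F i) (ε : F 0 →ₗ[S] M) : Prop where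
  free : ∀ i, Module.Free S (F i)
  surjective : Function.Surjective ε
  exact_zero : Function.Exact (d 0) ε
  exact_succ : ∀ i, Function.Exact (d (i + 1)) (d i)

/-- A complex over a polynomial ring is minimal if each differential has its image in
`(variables) • F i`. -/
def IsMinimalComplex {V 𝕜 : Type*} [Field 𝕜] {F : ℕ → Type*} [∀ i, AddCommGroup (F i)]
    [∀ i, Module (MvPolynomial V 𝕜) (F i)]
    (d : ∀ i, F (i + 1) →ₗ[MvPolynomial V 𝕜] F i) : Prop :=
  ∀ i, LinearMap.range (d i) ≤
    Ideal.span (Set.range (MvPolynomial.X : V → MvPolynomial V 𝕜)) •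
      (⊤ : Submodule (MvPolynomial V 𝕜) (F i))

/-- A monomial ideal `I` has a minimal Lyubeznik resolution: for some total order on its minimal
generators, the Lyubeznik resolution of `S / I` is a minimal free resolution. -/
def HasMinimalLyubeznikResolution {V 𝕜 : Type*} [Field 𝕜]
    (I : Ideal (MvPolynomial V 𝕜)) : Prop :=
  ∃ r : Mingens I → Mingens I → Prop, IsStrictTotalOrder (Mingens I) r ∧
    IsFreeResolution (Lyubeznik.diff r) (Lyubeznik.aug r) ∧
    IsMinimalComplex (Lyubeznik.diff r)

/-!
All products of `n` edges have degree `2n`, so the minimal generators of `I(G)ⁿ` are exactly these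
products (`minimal_edgeIdeal_pow_iff`).

Suppose that the Lyubeznik resolution for `≻` is minimal. The entries of its differential are `±
lcm σ / lcm (σ \ {m})`, so no element of a critical set `σ` may be redundant for the least common
multiple (`Lyubeznik.lcmOf_erase_ne`). Let `s` be the least generator, possibly among those
supported in a set `W` of vertices. A pair `{p, t}` such that no generator below both `p` and `t`
divides `lcm (p, t)` gives a critical set `{s, p, t}`, so `p` does not divide `lcm (s, t)`
(`Lyubeznik.not_le_sup_of_isMinimalComplex`). Two kinds of pairs suffice.

* On a triangle `x y z`, let `W = {x, y, z}`. The generator `s` has degree `2n ≥ 4`, so it is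
  divisible by the square of a vertex, say `x`. The generators dividing `M = x yⁿ zⁿ` are `M / x`,
  `M / y`, `M / z`, and a suitable pair of them contradicts minimality. Hence `G` has no triangle
  (`not_triangle_of_isMinimalComplex`).
* For an induced path `a - b - c`, the only generators dividing `aⁿ bⁿ c` are `(ab)ⁿ` and
  `(ab)ⁿ⁻¹(bc)`. With `W` the set of all vertices it follows that `s = (ab)ⁿ⁻¹(bc)` as soon as `c`
  divides `s` (`least_eq_of_induced_path`). If `G` has at least three vertices, this applies to
  the two directions of some path with three vertices, which forces `n = 2`; a fourth vertex,
  adjacent to one of the three, would have to divide `s`, which it does not.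

Conversely, suppose that a generator `w` divides `lcm (u, v)` for all distinct generators `u`,
`v`, and make `w` the least one. The critical sets are then `∅`, the singletons and the pairs `{u,
w}`, and the complex is checked to be exact and minimal by hand
(`hasMinimalLyubeznikResolution_of_le_sup`). In a relation `∑ gₐ a = 0` every monomial of `gᵤ u`
is divisible by a second generator, hence by `w`; so the relation can be reduced to one that
involves `w` only. For an edge there is a single generator, and for the path `x - y - z` and `n =
2` the generator `w = (xy)(yz)` divides `lcm ((xy)², (yz)²)`.
-/

/-! ### The generators of powers of edge ideals -/

open Finsupp in
/-- The exponent vectors of the products of `n` (not necessarily distinct) edges of `G`. -/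
def edgeSums {V : Type*} (G : SimpleGraph V) : ℕ → Set (V →₀ ℕ)
  | 0 => {0}
  | n + 1 => {a | ∃ b ∈ edgeSums G n, ∃ x y, G.Adj x y ∧ a = b + (single x 1 + single y 1)}

section EdgeSums

open Finsupp

variable {V : Type*} {G : SimpleGraph V}

theorem degree_of_mem_edgeSums {n : ℕ} {a : V →₀ ℕ} (ha : a ∈ edgeSums G n) :
    a.degree = 2 * n := by
  induction n generalizing a with
  | zero => simp_all [edgeSums]
  | succ n ih =>
    obtain ⟨b, hb, x, y, -, rfl⟩ := ha
    simp only [map_add, ih hb, degree_single]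
    ring

theorem add_mem_edgeSums {n : ℕ} {a : V →₀ ℕ} (ha : a ∈ edgeSums G n) {x y : V}
    (h : G.Adj x y) : a + (single x 1 + single y 1) ∈ edgeSums G (n + 1) :=
  ⟨a, ha, x, y, h, rfl⟩

theorem nsmul_mem_edgeSums (n : ℕ) {x y : V} (h : G.Adj x y) :
    n • (single x 1 + single y 1 : V →₀ ℕ) ∈ edgeSums G n := by
  induction n with
  | zero => simp [edgeSums]
  | succ n ih => rw [succ_nsmul]; exact add_mem_edgeSums ih h

theorem edgeIdeal_pow_eq_span (𝕜 : Type*) [Field 𝕜] (G : SimpleGraph V) (n : ℕ) :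
    edgeIdeal 𝕜 G ^ n =
      Ideal.span ((fun a => MvPolynomial.monomial a (1 : 𝕜)) '' edgeSums G n) := by
  induction n with
  | zero => simp [edgeSums]
  | succ n ih =>
    rw [pow_succ, ih, edgeIdeal, Ideal.span_mul_span']
    congr 1
    ext p
    simp only [Set.mem_mul, Set.mem_image, Set.mem_ofPred_eq, edgeSums]
    constructor
    · rintro ⟨_, ⟨a, ha, rfl⟩, _, ⟨x, y, h, rfl⟩, rfl⟩
      exact ⟨_, ⟨a, ha, x, y, h, rfl⟩, by simp [MvPolynomial.X, MvPolynomial.monomial_mul]⟩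
    · rintro ⟨_, ⟨a, ha, x, y, h, rfl⟩, rfl⟩
      exact ⟨_, ⟨a, ha, rfl⟩, _, ⟨x, y, h, rfl⟩,
        by simp [MvPolynomial.X, MvPolynomial.monomial_mul]⟩

theorem monomial_mem_edgeIdeal_pow {𝕜 : Type*} [Field 𝕜] {n : ℕ} {b : V →₀ ℕ} :
    MvPolynomial.monomial b (1 : 𝕜) ∈ edgeIdeal 𝕜 G ^ n ↔ ∃ a ∈ edgeSums G n, a ≤ b := by
  classical
  rw [edgeIdeal_pow_eq_span, MvPolynomial.mem_ideal_span_monomial_image]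
  simp [MvPolynomial.support_monomial]

theorem eq_of_le_of_degree_le {a b : V →₀ ℕ} (h : a ≤ b) (hd : b.degree ≤ a.degree) : a = b := by
  obtain ⟨c, rfl⟩ := exists_add_of_le h
  rw [map_add] at hd
  have : c.degree = 0 := by omega
  simp [(degree_eq_zero_iff c).1 this]

/-- All products of `n` edges have the same degree, so none of them is redundant. -/
theorem minimal_edgeIdeal_pow_iff {𝕜 : Type*} [Field 𝕜] {n : ℕ} {a : V →₀ ℕ} :
    Minimal (fun b : V →₀ ℕ => MvPolynomial.monomial b (1 : 𝕜) ∈ edgeIdeal 𝕜 G ^ n) a ↔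
      a ∈ edgeSums G n := by
  simp only [Minimal, monomial_mem_edgeIdeal_pow]
  constructor
  · rintro ⟨⟨b, hb, hba⟩, h⟩
    rwa [le_antisymm (h ⟨b, hb, le_rfl⟩ hba) hba]
  · refine fun ha => ⟨⟨a, ha, le_rfl⟩, ?_⟩
    rintro b ⟨c, hc, hcb⟩ hba
    rw [← eq_of_le_of_degree_le (hcb.trans hba)
      (by rw [degree_of_mem_edgeSums ha, degree_of_mem_edgeSums hc])]
    exact hcb

/-- A product of edges dividing a power of `a b c`, where `a` and `c` are not adjacent, only
involves the edges `ab` and `bc`. -/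
theorem exists_nsmul_of_mem_edgeSums {a b c : V} (hac : ¬ G.Adj a c) {n : ℕ} {m : V →₀ ℕ}
    (hm : m ∈ edgeSums G n) (hs : ∀ v, m v ≠ 0 → v = a ∨ v = b ∨ v = c) :
    ∃ i j, i + j = n ∧
      m = i • (single a 1 + single b 1) + j • (single b 1 + single c 1) := by
  induction n generalizing m with
  | zero => exact ⟨0, 0, rfl, by simpa [edgeSums] using hm⟩
  | succ n ih =>
    obtain ⟨m, hm, x, y, h, rfl⟩ := hm
    obtain ⟨i, j, hij, rfl⟩ := ih hm fun v hv => hs v (by simp at hv ⊢; omega)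
    have hx := hs x (by simp)
    have hy := hs y (by simp)
    have key : (single x 1 + single y 1 : V →₀ ℕ) = single a 1 + single b 1 ∨
        (single x 1 + single y 1 : V →₀ ℕ) = single b 1 + single c 1 := by
      rcases hx with rfl | rfl | rfl <;> rcases hy with rfl | rfl | rfl <;>
        first
        | exact absurd h (G.irrefl)
        | exact absurd h hac
        | exact absurd h.symm hac
        | exact Or.inl rfl
        | exact Or.inr rfl
        | exact Or.inl (add_comm _ _)
        | exact Or.inr (add_comm _ _)
    rcases key with e | e
    · exact ⟨i + 1, j, by omega, by rw [e, succ_nsmul]; abel⟩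
    · exact ⟨i, j + 1, by omega, by rw [e, succ_nsmul]; abel⟩

end EdgeSums

/-! ### Redundant elements of critical sets -/

namespace Lyubeznik

variable {V 𝕜 : Type*} [Field 𝕜] {I : Ideal (MvPolynomial V 𝕜)} {r : Mingens I → Mingens I → Prop}

open scoped Classical in
theorem diff_single {i : ℕ} (σ : Crit r (i + 1)) (c : MvPolynomial V 𝕜) :
    diff r i (Finsupp.single σ c) = c • ∑ a ∈ σ.1.attach,
      Finsupp.single (facet σ a.1 a.2)
        ((-1 : MvPolynomial V 𝕜) ^ (σ.1.filter (fun b => r b a.1)).card *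
          MvPolynomial.monomial (lcmOf σ.1 - lcmOf (facet σ a.1 a.2).1) 1) := by
  simp [diff]

open scoped Classical in
/-- In a minimal Lyubeznik resolution no element of a critical set is redundant for the least
common multiple: otherwise the differential would have a unit `± 1` among its entries. -/
theorem lcmOf_erase_ne (h : IsMinimalComplex (diff r)) {σ : Finset (Mingens I)}
    (hσ : IsCritical r σ) {a : Mingens I} (ha : a ∈ σ) : lcmOf (σ.erase a) ≠ lcmOf σ := by
  intro heq
  obtain ⟨i, hi⟩ : ∃ i, σ.card = i + 1 := ⟨σ.card - 1, by
    have := Finset.card_pos.2 ⟨a, ha⟩; omega⟩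
  let s : Crit r (i + 1) := ⟨σ, hσ, hi⟩
  have h1 := h i ⟨Finsupp.single s 1, rfl⟩
  -- Read off the coefficient at the facet `σ \ {a}`, and then its constant term.
  have h2 : (diff r i (Finsupp.single s 1)) (facet s a ha) ∈
      Ideal.span (Set.range (MvPolynomial.X : V → MvPolynomial V 𝕜)) := by
    have := Submodule.mem_map_of_mem (f := Finsupp.lapply (R := MvPolynomial V 𝕜) (facet s a ha)) h1
    rw [Submodule.map_smul''] at this
    exact (Submodule.smul_mono le_rfl le_top).trans_eq (Ideal.mul_top _) this
  have h3 : (diff r i (Finsupp.single s 1)) (facet s a ha) =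
      (-1 : MvPolynomial V 𝕜) ^ (σ.filter (fun b => r b a)).card := by
    rw [diff_single, one_smul, Finsupp.finsetSum_apply, Finset.sum_eq_single ⟨a, ha⟩]
    · have : lcmOf s.1 - lcmOf (facet s a ha).1 = 0 := by
        change lcmOf σ - lcmOf (σ.erase a) = 0
        rw [heq, tsub_self]
      simp [this, s]
    · rintro ⟨b, hb⟩ - hba
      refine Finsupp.single_eq_of_ne fun hf => hba ?_
      have hf' : σ.erase a = σ.erase b := congrArg Subtype.val hf
      by_contra hne
      have : b ∈ σ.erase a := Finset.mem_erase.2 ⟨fun e => hne (Subtype.ext e), hb⟩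
      rw [hf'] at this
      exact Finset.notMem_erase _ _ this
    · exact fun hn => absurd (Finset.mem_attach _ _) hn
  rw [h3] at h2
  have h4 : Ideal.span (Set.range (MvPolynomial.X : V → MvPolynomial V 𝕜)) ≤
      RingHom.ker (MvPolynomial.constantCoeff : MvPolynomial V 𝕜 →+* 𝕜) := by
    rw [Ideal.span_le]
    rintro _ ⟨v, rfl⟩
    simp
  have h5 := h4 h2
  rw [RingHom.mem_ker, map_pow, map_neg, map_one] at h5
  exact pow_ne_zero _ (neg_ne_zero.2 one_ne_zero) h5

/-- The obstruction to minimality. Let `s` be the least generator among those supported in `W`. If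
no generator dividing `lcm (p, t)` lies below both `p` and `t`, then `{s, p, t}` is critical; so in
a minimal resolution `p` does not divide `lcm (s, t)`. -/
theorem not_le_sup_of_isMinimalComplex [IsStrictTotalOrder (Mingens I) r]
    (h : IsMinimalComplex (diff r)) (W : Set V) {s p t : Mingens I}
    (hs : ∀ m : Mingens I, (∀ v, m.1 v ≠ 0 → v ∈ W) → ¬ r s m)
    (hsW : ∀ v, s.1 v ≠ 0 → v ∈ W) (hpW : ∀ v, p.1 v ≠ 0 → v ∈ W) (htW : ∀ v, t.1 v ≠ 0 → v ∈ W)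
    (hsp : p ≠ s) (hpt : p ≠ t)
    (hm : ∀ m : Mingens I, m.1 ≤ p.1 ⊔ t.1 → ¬ (r p m ∧ r t m)) :
    ¬ p.1 ≤ s.1 ⊔ t.1 := by
  classical
  intro hle
  have hcrit : IsCritical r {s, p, t} := by
    rintro ⟨m, x, hx, ⟨y, hy, hyx⟩, hxm, hmle⟩
    have hnot : ∀ z, (∀ v, z.1 v ≠ 0 → v ∈ W) → r x z → x ≠ s := by
      rintro z hz hxz rfl
      exact hs z hz hxz
    have hmW : ∀ v, m.1 v ≠ 0 → v ∈ W := by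
      have h1 : m.1 ≤ s.1 ⊔ (p.1 ⊔ t.1) := hmle.trans ((Finset.sup_mono
        (Finset.filter_subset _ _)).trans (by simp [Finset.sup_insert]))
      intro v hv
      have h2 := h1 v
      simp only [Finsupp.sup_apply] at h2
      by_contra hvW
      rw [not_imp_comm.1 (hsW v) hvW, not_imp_comm.1 (hpW v) hvW,
        not_imp_comm.1 (htW v) hvW] at h2
      exact hv (by simpa using h2)
    have hxs := hnot m hmW hxm
    have hxW : ∀ v, x.1 v ≠ 0 → v ∈ W := by
      simp only [Finset.mem_insert, Finset.mem_singleton] at hx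
      rcases hx with rfl | rfl | rfl <;> assumption
    have hys : y ≠ s := by
      rintro rfl
      exact hs x hxW hyx
    have hxy : x ≠ y := by
      rintro rfl
      exact irrefl_of r _ hyx
    have hle' : m.1 ≤ p.1 ⊔ t.1 := by
      refine hmle.trans (Finset.sup_le fun z hz => ?_)
      simp only [Finset.mem_filter, Finset.mem_insert, Finset.mem_singleton] at hz
      obtain ⟨rfl | rfl | rfl, hz⟩ := hz
      · rcases hz with rfl | hz
        · exact absurd rfl hxs
        · exact absurd hz (hs x hxW)
      · exact le_sup_left
      · exact le_sup_right
    have hym := trans_of r hyx hxm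
    simp only [Finset.mem_insert, Finset.mem_singleton] at hx hy
    apply hm m hle'
    rcases hx with rfl | rfl | rfl <;> rcases hy with rfl | rfl | rfl <;> simp_all
  refine lcmOf_erase_ne h hcrit (a := p) (by simp) (le_antisymm
    (Finset.sup_mono (Finset.erase_subset _ _)) (Finset.sup_le fun z hz => ?_))
  by_cases hzp : z = p
  · subst hzp
    refine hle.trans (sup_le ?_ ?_)
    · exact Finset.le_sup (f := fun a : Mingens I => a.1) (by simp [hsp.symm])
    · exact Finset.le_sup (f := fun a : Mingens I => a.1) (by simp [hpt.symm])
  · exact Finset.le_sup (f := fun a : Mingens I => a.1) (Finset.mem_erase.2 ⟨hzp, hz⟩)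

end Lyubeznik

/-! ### Finding paths in connected graphs -/

section Graph

variable {V : Type*} {G : SimpleGraph V}

theorem SimpleGraph.Connected.exists_adj_mem_notMem (hG : G.Connected) {S : Set V} {u : V}
    (hu : u ∈ S) (hS : S ≠ Set.univ) : ∃ v ∈ S, ∃ w ∉ S, G.Adj v w := by
  obtain ⟨w, hw⟩ := (Set.ne_univ_iff_exists_notMem S).1 hS
  obtain ⟨p⟩ := hG.preconnected u w
  obtain ⟨d, -, h1, h2⟩ := p.exists_boundary_dart S hu hw
  exact ⟨_, h1, _, h2, d.adj⟩

theorem nonempty_iso_pathGraph_two {x y : V} (h : G.Adj x y) (hV : ({x, y} : Set V) = Set.univ) :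
    Nonempty (G ≃g SimpleGraph.pathGraph 2) := by
  have hb : Function.Bijective ![x, y] := by
    constructor
    · intro i j hij
      have := h.ne
      fin_cases i <;> fin_cases j <;> simp_all
    · intro v
      have : v ∈ ({x, y} : Set V) := hV ▸ trivial
      rcases this with rfl | rfl
      exacts [⟨0, rfl⟩, ⟨1, rfl⟩]
  refine ⟨(RelIso.mk (Equiv.ofBijective _ hb) ?_ : SimpleGraph.pathGraph 2 ≃g G).symm⟩
  intro i j
  rw [SimpleGraph.pathGraph_adj]
  fin_cases i <;> fin_cases j <;> simp [h, h.symm]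

theorem nonempty_iso_pathGraph_three {x y z : V} (hxy : G.Adj x y) (hyz : G.Adj y z)
    (hxz : ¬ G.Adj x z) (hne : x ≠ z) (hV : ({x, y, z} : Set V) = Set.univ) :
    Nonempty (G ≃g SimpleGraph.pathGraph 3) := by
  have hb : Function.Bijective ![x, y, z] := by
    constructor
    · intro i j hij
      have := hxy.ne
      have := hyz.ne
      fin_cases i <;> fin_cases j <;> simp_all
    · intro v
      have : v ∈ ({x, y, z} : Set V) := hV ▸ trivial
      rcases this with rfl | rfl | rfl
      exacts [⟨0, rfl⟩, ⟨1, rfl⟩, ⟨2, rfl⟩]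
  refine ⟨(RelIso.mk (Equiv.ofBijective _ hb) ?_ : SimpleGraph.pathGraph 3 ≃g G).symm⟩
  have hzx : ¬ G.Adj z x := fun h => hxz h.symm
  intro i j
  rw [SimpleGraph.pathGraph_adj]
  fin_cases i <;> fin_cases j <;> simp [hxy, hxy.symm, hyz, hyz.symm, hxz, hzx]

end Graph

/-! ### Graphs whose powers have a minimal Lyubeznik resolution -/

section Necessity

open Finsupp Lyubeznik

variable {V 𝕜 : Type*} [Field 𝕜] {G : SimpleGraph V} {n : ℕ}
  {r : Mingens (edgeIdeal 𝕜 G ^ n) → Mingens (edgeIdeal 𝕜 G ^ n) → Prop}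

theorem exists_least_generator [Finite V] (𝕜 : Type*) [Field 𝕜]
    (r : Mingens (edgeIdeal 𝕜 G ^ n) → Mingens (edgeIdeal 𝕜 G ^ n) → Prop)
    [IsStrictTotalOrder (Mingens (edgeIdeal 𝕜 G ^ n)) r] (W : Set V)
    (h : ∃ m : Mingens (edgeIdeal 𝕜 G ^ n), ∀ v, m.1 v ≠ 0 → v ∈ W) :
    ∃ s : Mingens (edgeIdeal 𝕜 G ^ n), (∀ v, s.1 v ≠ 0 → v ∈ W) ∧
      ∀ m : Mingens (edgeIdeal 𝕜 G ^ n), (∀ v, m.1 v ≠ 0 → v ∈ W) → ¬ r s m := by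
  have hfin : Finite (Mingens (edgeIdeal 𝕜 G ^ n)) :=
    ((finite_of_degree_eq (σ := V) (2 * n)).subset fun a ha =>
      degree_of_mem_edgeSums (minimal_edgeIdeal_pow_iff.1 ha)).to_subtype
  obtain ⟨s, hsW, hs⟩ := (Finite.wellFounded_of_trans_of_irrefl (Function.swap r)).has_min
    {m | ∀ v, m.1 v ≠ 0 → v ∈ W} h
  exact ⟨s, hsW, fun m hm => hs m hm⟩

/-- If `a - b - c` is an induced path and the least generator `s` is divisible by `c`, then `s` has
to be `(ab)ⁿ⁻¹(bc)`: the only generators dividing `aⁿbⁿc` are `(ab)ⁿ` and `(ab)ⁿ⁻¹(bc)`, and the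
latter divides the least common multiple of `(ab)ⁿ` and `s`. -/
theorem least_eq_of_induced_path [IsStrictTotalOrder (Mingens (edgeIdeal 𝕜 G ^ n)) r]
    (h : IsMinimalComplex (diff r)) (hn : n ≠ 0) {s : Mingens (edgeIdeal 𝕜 G ^ n)}
    (hs : ∀ m, ¬ r s m) {a b c : V} (hab : G.Adj a b) (hbc : G.Adj b c) (hac : ¬ G.Adj a c)
    (hne : a ≠ c) (hsc : s.1 c ≠ 0) :
    s.1 = (n - 1) • (single a 1 + single b 1) + (single b 1 + single c 1) := by
  classical
  obtain ⟨n, rfl⟩ := Nat.exists_eq_succ_of_ne_zero hn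
  have hbc' := hbc.ne
  have hab' := hab.ne
  by_contra hsp
  -- `t = (ab)ⁿ` and `p = (ab)ⁿ⁻¹(bc)`, with `n + 1` in place of `n`
  let t : Mingens (edgeIdeal 𝕜 G ^ (n + 1)) :=
    ⟨_, minimal_edgeIdeal_pow_iff.2 (nsmul_mem_edgeSums (n + 1) hab)⟩
  let p : Mingens (edgeIdeal 𝕜 G ^ (n + 1)) :=
    ⟨_, minimal_edgeIdeal_pow_iff.2 (add_mem_edgeSums (nsmul_mem_edgeSums n hab) hbc)⟩
  have hpc : p.1 c = 1 := by simp [p, hbc', hne]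
  have htc : t.1 c = 0 := by simp [t, hbc', hne]
  refine not_le_sup_of_isMinimalComplex h Set.univ (s := s) (p := p) (t := t) (fun m _ => hs m)
    (fun _ _ => trivial) (fun _ _ => trivial) (fun _ _ => trivial) ?_ ?_ ?_ ?_
  · rintro rfl
    exact hsp rfl
  · intro e
    rw [e, htc] at hpc
    omega
  · -- A generator dividing `lcm (p, t)` is `(ab)ⁱ(bc)ʲ` with `j ≤ 1`, hence is `t` or `p`.
    rintro m hm ⟨hpm, htm⟩
    have hle : ∀ v, m.1 v ≤ max (p.1 v) (t.1 v) := fun v => by simpa using hm v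
    obtain ⟨i, j, hij, he⟩ := exists_nsmul_of_mem_edgeSums (a := a) (b := b) (c := c) hac
      (minimal_edgeIdeal_pow_iff.1 m.2) (by
        intro v hv
        by_contra! hcon
        have := hle v
        simp [p, t, hcon.1.symm, hcon.2.1.symm, hcon.2.2.symm] at this
        exact hv this)
    have hc := hle c
    rw [hpc, htc, he] at hc
    simp [hbc', hne] at hc
    have : j = 0 ∨ j = 1 := by omega
    rcases this with rfl | rfl
    · have : m = t := Subtype.ext (by rw [he]; simp [t, show i = n + 1 by omega])
      subst this
      exact irrefl_of r _ htm
    · have : m = p := Subtype.ext (by rw [he]; simp [p, show i = n by omega])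
      subst this
      exact irrefl_of r _ hpm
  · intro v
    by_cases hv : v = c
    · subst hv
      rw [hpc]
      simp only [Finsupp.sup_apply]
      omega
    · have : p.1 v ≤ t.1 v := by
        simp only [p, t, succ_nsmul]
        simp [single_apply, Ne.symm hv]
      simpa using Or.inr this

/-- The least generator among those supported in a set `W` that contains a triangle `x y z` is not
divisible by `x²`. The generators dividing `M = x yⁿ zⁿ` are `M / x`, `M / y` and `M / z`. One of
`M / y` and `M / z` does not lie above the other; paired with `M / x` it yields a redundant critical
set. -/
theorem least_apply_lt_two_of_triangle [IsStrictTotalOrder (Mingens (edgeIdeal 𝕜 G ^ n)) r]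
    (h : IsMinimalComplex (diff r)) (hn : n ≠ 0) {x y z : V} (hxy : G.Adj x y) (hyz : G.Adj y z)
    (hxz : G.Adj x z) {W : Set V} (hxW : x ∈ W) (hyW : y ∈ W) (hzW : z ∈ W)
    {s : Mingens (edgeIdeal 𝕜 G ^ n)} (hsW : ∀ v, s.1 v ≠ 0 → v ∈ W)
    (hs : ∀ m : Mingens (edgeIdeal 𝕜 G ^ n), (∀ v, m.1 v ≠ 0 → v ∈ W) → ¬ r s m) :
    s.1 x < 2 := by
  classical
  obtain ⟨n, rfl⟩ := Nat.exists_eq_succ_of_ne_zero hn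
  by_contra! hsx
  have hxy' := hxy.ne
  have hyz' := hyz.ne
  have hxz' := hxz.ne
  let M : V →₀ ℕ := single x 1 + (n + 1) • (single y 1 + single z 1)
  let px : Mingens (edgeIdeal 𝕜 G ^ (n + 1)) :=
    ⟨_, minimal_edgeIdeal_pow_iff.2 (nsmul_mem_edgeSums (n + 1) hyz)⟩
  let py : Mingens (edgeIdeal 𝕜 G ^ (n + 1)) :=
    ⟨_, minimal_edgeIdeal_pow_iff.2 (add_mem_edgeSums (nsmul_mem_edgeSums n hyz) hxz)⟩
  let pz : Mingens (edgeIdeal 𝕜 G ^ (n + 1)) :=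
    ⟨_, minimal_edgeIdeal_pow_iff.2 (add_mem_edgeSums (nsmul_mem_edgeSums n hyz) hxy)⟩
  have hMx : px.1 + single x 1 = M := by simp only [px, M, succ_nsmul]; abel
  have hMy : py.1 + single y 1 = M := by simp only [py, M, succ_nsmul]; abel
  have hMz : pz.1 + single z 1 = M := by simp only [pz, M, succ_nsmul]; abel
  have hM : ∀ m : Mingens (edgeIdeal 𝕜 G ^ (n + 1)), m.1 ≤ M → m = px ∨ m = py ∨ m = pz := by
    intro m hm
    obtain ⟨d, hd⟩ := exists_add_of_le hm
    have hdeg : d.degree = 1 := by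
      have h1 := congrArg Finsupp.degree (hMx.trans hd)
      rw [map_add, map_add, degree_of_mem_edgeSums (minimal_edgeIdeal_pow_iff.1 m.2),
        degree_of_mem_edgeSums (minimal_edgeIdeal_pow_iff.1 px.2), degree_single] at h1
      omega
    have hd' : d ∈ Set.range (fun a : V => single a 1) := by
      rw [Finsupp.range_single_one]; exact hdeg
    obtain ⟨v, rfl⟩ := hd'
    have hv : v = x ∨ v = y ∨ v = z := by
      by_contra! hcon
      have := DFunLike.congr_fun hd v
      simp [M, hcon.1.symm, hcon.2.1.symm, hcon.2.2.symm] at this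
    rcases hv with rfl | rfl | rfl
    · exact Or.inl (Subtype.ext (add_right_cancel (hd.symm.trans hMx.symm)))
    · exact Or.inr (Or.inl (Subtype.ext (add_right_cancel (hd.symm.trans hMy.symm))))
    · exact Or.inr (Or.inr (Subtype.ext (add_right_cancel (hd.symm.trans hMz.symm))))
  have hleM : ∀ {p : V →₀ ℕ} {v : V}, p + single v 1 = M → p ≤ M := fun e => e ▸ le_self_add
  have hMW : ∀ {p : V →₀ ℕ}, p ≤ M → ∀ v, p v ≠ 0 → v ∈ W := by
    intro p hp v hv
    by_contra hvW
    have h1 := hp v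
    have e1 : x ≠ v := fun e => hvW (e ▸ hxW)
    have e2 : y ≠ v := fun e => hvW (e ▸ hyW)
    have e3 : z ≠ v := fun e => hvW (e ▸ hzW)
    simp [M, e1, e2, e3] at h1
    exact hv h1
  have hMx1 : M x = 1 := by simp [M, hxy'.symm, hxz'.symm]
  -- The pair of `M / x` and `p = M / v` gives a contradiction unless the third divisor `q` of `M`
  -- lies below `p`.
  have key : ∀ (v : V) (p q : Mingens (edgeIdeal 𝕜 G ^ (n + 1))), v ≠ x → p.1 + single v 1 = M →
      (∀ m, m.1 ≤ M → m = px ∨ m = p ∨ m = q) → ¬ r p q → False := by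
    intro v p q hvx hp hM' hpq
    have hpx : p.1 x ≤ 1 := (hleM hp x).trans_eq hMx1
    refine not_le_sup_of_isMinimalComplex h W (s := s) (p := p) (t := px) hs hsW (hMW (hleM hp))
      (hMW (hleM hMx)) ?_ ?_ ?_ ?_
    · rintro rfl
      omega
    · intro e
      rw [e, ← hMx] at hp
      exact hvx (single_left_injective one_ne_zero (add_left_cancel hp))
    · rintro m hm ⟨hpm, hxm⟩
      rcases hM' m (hm.trans (sup_le (hleM hp) (hleM hMx))) with rfl | rfl | rfl
      · exact irrefl_of r _ hxm
      · exact irrefl_of r _ hpm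
      · exact hpq hpm
    · intro w
      rw [Finsupp.sup_apply]
      by_cases hw : w = x
      · subst hw
        exact le_sup_of_le_left (by omega)
      · refine le_sup_of_le_right ((hleM hp w).trans_eq ?_)
        rw [← hMx, Finsupp.add_apply, single_eq_of_ne hw, add_zero]
  by_cases hr : r py pz
  · exact key z pz py hxz'.symm hMz (fun m hm => by have := hM m hm; tauto) (asymm_of r hr)
  · exact key y py pz hxy'.symm hMy hM hr

/-- In a minimal Lyubeznik resolution of a power of the edge ideal, `G` has no triangle. -/
theorem not_triangle_of_isMinimalComplex [Finite V]
    [IsStrictTotalOrder (Mingens (edgeIdeal 𝕜 G ^ n)) r] (h : IsMinimalComplex (diff r))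
    (hn : 2 ≤ n) {x y z : V} (hxy : G.Adj x y) (hyz : G.Adj y z) (hxz : G.Adj x z) : False := by
  classical
  have : Fintype V := Fintype.ofFinite V
  have hn0 : n ≠ 0 := by omega
  have hx : x ∈ ({x, y, z} : Set V) := by simp
  have hy : y ∈ ({x, y, z} : Set V) := by simp
  have hz : z ∈ ({x, y, z} : Set V) := by simp
  obtain ⟨s, hsW, hs⟩ := exists_least_generator 𝕜 r {x, y, z}
    ⟨⟨_, minimal_edgeIdeal_pow_iff.2 (nsmul_mem_edgeSums n hxy)⟩, fun v hv => by
      by_contra hcon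
      simp only [Set.mem_insert_iff, Set.mem_singleton_iff, not_or] at hcon
      exact hv (by simp [Ne.symm hcon.1, Ne.symm hcon.2.1])⟩
  have h1 := least_apply_lt_two_of_triangle h hn0 hxy hyz hxz hx hy hz hsW hs
  have h2 := least_apply_lt_two_of_triangle h hn0 hyz hxz.symm hxy.symm hy hz hx hsW hs
  have h3 := least_apply_lt_two_of_triangle h hn0 hxz.symm hxy hyz.symm hz hx hy hsW hs
  have hdeg := degree_of_mem_edgeSums (minimal_edgeIdeal_pow_iff.1 s.2)
  rw [degree_eq_sum, ← Finset.sum_subset (Finset.subset_univ {x, y, z})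
    (fun v _ hv => by_contra fun hsv => hv (by simpa using hsW v hsv)),
    Finset.sum_insert (by simp [hxy.ne, hxz.ne]), Finset.sum_pair hyz.ne] at hdeg
  omega

/-- For a triangle-free graph, compare the least generator `s` with every path of length two whose
endpoint divides `s`: it equals both `(zy)ⁿ⁻¹(yx)` and `(xy)ⁿ⁻¹(yz)`, so `n = 2`, and a fourth
vertex adjacent to one of `x, y, z` would have to divide it. -/
theorem pathGraph_of_hasMinimalLyubeznikResolution {V 𝕜 : Type*} [Finite V] [Field 𝕜]
    {G : SimpleGraph V} (hG : G.Connected) (hE : G.edgeSet.Nonempty) {n : ℕ} (hn : 2 ≤ n)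
    (h : HasMinimalLyubeznikResolution (edgeIdeal 𝕜 G ^ n)) :
    Nonempty (G ≃g SimpleGraph.pathGraph 2) ∨
      (n = 2 ∧ Nonempty (G ≃g SimpleGraph.pathGraph 3)) := by
  obtain ⟨r, hr, -, h⟩ := h
  have hn0 : n ≠ 0 := by omega
  have htri : ∀ {a b c : V}, G.Adj a b → G.Adj b c → ¬ G.Adj a c :=
    fun hab hbc hac => not_triangle_of_isMinimalComplex h hn hab hbc hac
  obtain ⟨e, he⟩ := hE
  induction e with | _ a b
  have hab : G.Adj a b := he
  obtain ⟨s, -, hs⟩ := exists_least_generator 𝕜 r Set.univ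
    ⟨⟨_, minimal_edgeIdeal_pow_iff.2 (nsmul_mem_edgeSums n hab)⟩, fun _ _ => trivial⟩
  have hpath : ∀ {a b c : V}, G.Adj a b → G.Adj b c → a ≠ c → s.1 c ≠ 0 →
      s.1 = (n - 1) • (single a 1 + single b 1) + (single b 1 + single c 1) :=
    fun hab hbc hne hc =>
      least_eq_of_induced_path h hn0 (fun m => hs m fun _ _ => trivial) hab hbc (htri hab hbc)
        hne hc
  refine or_iff_not_imp_left.2 fun hP2 => ?_
  -- An edge `xy` whose vertices both divide `s`, and another neighbour `z` of `y`.
  obtain ⟨x, y, z, hxy, hyz, hxz, hsx, hsy⟩ : ∃ x y z, G.Adj x y ∧ G.Adj y z ∧ x ≠ z ∧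
      s.1 x ≠ 0 ∧ s.1 y ≠ 0 := by
    have hsmem := minimal_edgeIdeal_pow_iff.1 s.2
    obtain ⟨k, hk⟩ := Nat.exists_eq_succ_of_ne_zero hn0
    have hsmem' : s.1 ∈ edgeSums G (k + 1) := by rw [← Nat.succ_eq_add_one, ← hk]; exact hsmem
    obtain ⟨m, -, x, y, hxy, hm⟩ := hsmem'
    have hsx : s.1 x ≠ 0 := by simp [hm]
    have hsy : s.1 y ≠ 0 := by simp [hm]
    obtain ⟨v, hv, z, hz, hvz⟩ := hG.exists_adj_mem_notMem (S := {x, y}) (u := x) (by simp)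
      fun hV => hP2 (nonempty_iso_pathGraph_two hxy hV)
    simp only [Set.mem_insert_iff, Set.mem_singleton_iff, not_or] at hz
    rcases hv with rfl | rfl
    · exact ⟨y, v, z, hxy.symm, hvz, Ne.symm hz.2, hsy, hsx⟩
    · exact ⟨x, v, z, hxy, hvz, Ne.symm hz.1, hsx, hsy⟩
  have hxy' := hxy.ne
  have hyz' := hyz.ne
  have e1 := hpath hyz.symm hxy.symm hxz.symm hsx
  have hsz : s.1 z ≠ 0 := by
    rw [e1]
    simp
    omega
  have e2 := hpath hxy hyz hxz hsz
  -- Compare the exponents of `x` in `s = (zy)ⁿ⁻¹(yx) = (xy)ⁿ⁻¹(yz)`.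
  have hn2 : n = 2 := by
    have := DFunLike.congr_fun (e1.symm.trans e2) x
    simp [hxy'.symm, hxz.symm] at this
    omega
  refine ⟨hn2, nonempty_iso_pathGraph_three hxy hyz (htri hxy hyz) hxz ?_⟩
  by_contra hV
  obtain ⟨v, hv, d, hd, hvd⟩ := hG.exists_adj_mem_notMem (S := {x, y, z}) (u := x) (by simp) hV
  obtain ⟨u, hvu, hud, hsu⟩ : ∃ u, G.Adj v u ∧ d ≠ u ∧ s.1 u ≠ 0 := by
    simp only [Set.mem_insert_iff, Set.mem_singleton_iff, not_or] at hd
    rcases hv with rfl | rfl | rfl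
    · exact ⟨y, hxy, hd.2.1, hsy⟩
    · exact ⟨x, hxy.symm, hd.1, hsx⟩
    · exact ⟨y, hyz.symm, hd.2.1, hsy⟩
  have e3 := DFunLike.congr_fun (e1.symm.trans (hpath hvd.symm hvu hud hsu)) d
  simp only [Set.mem_insert_iff, Set.mem_singleton_iff, not_or] at hd
  simp [Ne.symm hd.1, Ne.symm hd.2.1, Ne.symm hd.2.2] at e3
  omega

end Necessity

/-! ### Ideals with a generator dividing all pairwise least common multiples -/

namespace Lyubeznik

variable {V 𝕜 : Type*} [Field 𝕜] {I : Ideal (MvPolynomial V 𝕜)} {r : Mingens I → Mingens I → Prop}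

/-- The empty set, the only basis element in homological degree `0`. -/
def emptyCrit (r : Mingens I → Mingens I → Prop) : Crit r 0 :=
  ⟨∅, by simp [IsCritical], rfl⟩

theorem eq_emptyCrit (σ : Crit r 0) : σ = emptyCrit r :=
  Subtype.ext (Finset.card_eq_zero.1 σ.2.2)

theorem aug_single (f : MvPolynomial V 𝕜) :
    aug r (Finsupp.single (emptyCrit r) f) = Ideal.Quotient.mk I f := by
  rw [aug, Finsupp.linearCombination_single]
  change Ideal.Quotient.mk I (f * 1) = _
  rw [mul_one]

variable [IsStrictTotalOrder (Mingens I) r]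

/-- The basis element in homological degree `1` that belongs to the generator `a`. -/
def vertexCrit (r : Mingens I → Mingens I → Prop) [IsStrictTotalOrder (Mingens I) r]
    (a : Mingens I) : Crit r 1 :=
  ⟨{a}, by
    rintro ⟨m, p, hp, ⟨q, hq, hqp⟩, -⟩
    rw [Finset.mem_singleton] at hp hq
    subst hp hq
    exact irrefl_of r _ hqp, Finset.card_singleton a⟩

theorem exists_eq_vertexCrit (σ : Crit r 1) : ∃ a, σ = vertexCrit r a := by
  obtain ⟨a, ha⟩ := Finset.card_eq_one.1 σ.2.2
  exact ⟨a, Subtype.ext ha⟩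

theorem vertexCrit_injective : Function.Injective (vertexCrit r) := fun _ _ h =>
  Finset.singleton_injective (congrArg Subtype.val h)

open scoped Classical in
/-- The basis element `{u, w}` in homological degree `2`, for `w` the least generator. -/
noncomputable def edgeCrit {w : Mingens I} (hr : ∀ u, u ≠ w → r u w) {u : Mingens I}
    (hu : u ≠ w) : Crit r 2 :=
  ⟨{u, w}, by
    rintro ⟨m, p, hp, ⟨q, hq, hqp⟩, hpm, -⟩
    have hw : ∀ x, ¬ r w x := fun x hx => by
      by_cases h : x = w
      · subst h; exact irrefl_of r _ hx
      · exact asymm_of r hx (hr x h)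
    simp only [Finset.mem_insert, Finset.mem_singleton] at hp hq
    rcases hp with rfl | rfl
    · rcases hq with rfl | rfl
      · exact irrefl_of r _ hqp
      · exact hw _ hqp
    · exact hw _ hpm, Finset.card_pair hu⟩

theorem edgeCrit_val [DecidableEq (Mingens I)] {w : Mingens I} (hr : ∀ u, u ≠ w → r u w)
    {u : Mingens I} (hu : u ≠ w) : (edgeCrit hr hu).1 = {u, w} := by
  ext; simp [edgeCrit]

/-- If the least generator `w` divides `lcm (u, v)`, then `u` and `v` do not occur together in a
critical set. -/
theorem eq_or_eq_of_isCritical {w : Mingens I} (hw : ∀ u v : Mingens I, u ≠ v → w.1 ≤ u.1 ⊔ v.1)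
    (hr : ∀ u, u ≠ w → r u w) {σ : Finset (Mingens I)} (hσ : IsCritical r σ) {u v : Mingens I}
    (hu : u ∈ σ) (hv : v ∈ σ) (huv : u ≠ v) : u = w ∨ v = w := by
  classical
  by_contra! hcon
  wlog h : r u v generalizing u v
  · exact this hv hu huv.symm hcon.symm
      ((trichotomous_of r u v).resolve_left h |>.resolve_left huv)
  refine hσ ⟨w, v, hv, ⟨u, hu, h⟩, hr v hcon.2, (hw u v huv).trans (sup_le ?_ ?_)⟩
  · exact Finset.le_sup (f := fun a : Mingens I => a.1) (by simp [hu, h])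
  · exact Finset.le_sup (f := fun a : Mingens I => a.1) (by simp [hv])

theorem exists_eq_edgeCrit {w : Mingens I} (hw : ∀ u v : Mingens I, u ≠ v → w.1 ≤ u.1 ⊔ v.1)
    (hr : ∀ u, u ≠ w → r u w) (σ : Crit r 2) : ∃ u, ∃ hu : u ≠ w, σ = edgeCrit hr hu := by
  classical
  obtain ⟨σ, hσ, hcard⟩ := σ
  obtain ⟨u, v, huv, rfl⟩ := Finset.card_eq_two.1 hcard
  rcases eq_or_eq_of_isCritical hw hr hσ (u := u) (v := v) (by simp) (by simp) huv with rfl | rfl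
  · exact ⟨v, huv.symm, Subtype.ext ((Finset.pair_comm _ _).trans (edgeCrit_val hr huv.symm).symm)⟩
  · exact ⟨u, huv, Subtype.ext (by rw [edgeCrit_val])⟩

theorem isEmpty_crit {w : Mingens I} (hw : ∀ u v : Mingens I, u ≠ v → w.1 ≤ u.1 ⊔ v.1)
    (hr : ∀ u, u ≠ w → r u w) (i : ℕ) : IsEmpty (Crit r (i + 3)) := by
  refine ⟨fun ⟨σ, hσ, hcard⟩ => ?_⟩
  obtain ⟨a, b, c, ha, hb, hc, hab, hac, hbc⟩ := Finset.two_lt_card_iff.1 (show 2 < σ.card by omega)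
  rcases eq_or_eq_of_isCritical hw hr hσ ha hb hab with rfl | rfl
  · rcases eq_or_eq_of_isCritical hw hr hσ hb hc hbc with rfl | rfl <;> contradiction
  · rcases eq_or_eq_of_isCritical hw hr hσ ha hc hac with rfl | rfl <;> contradiction

theorem diff_zero_single (a : Mingens I) (c : MvPolynomial V 𝕜) :
    diff r 0 (Finsupp.single (vertexCrit r a) c) =
      Finsupp.single (emptyCrit r) (c * MvPolynomial.monomial a.1 1) := by
  classical
  rw [diff_single, Finset.sum_eq_single ⟨a, by simp [vertexCrit]⟩]
  · rw [eq_emptyCrit (facet _ _ _), Finsupp.smul_single]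
    have : ({a} : Finset (Mingens I)).filter (fun b => r b a) = ∅ := by
      simp [Finset.filter_singleton, irrefl_of r a]
    have h0 : lcmOf (emptyCrit r).1 = 0 := Finset.sup_empty
    have h1 : lcmOf (vertexCrit r a).1 = a.1 := Finset.sup_singleton
    rw [h0, h1, tsub_zero]
    simp only [vertexCrit, this, Finset.card_empty, pow_zero, one_mul, smul_eq_mul]
  · rintro ⟨b, hb⟩ - hne
    exact absurd (Subtype.ext (Finset.mem_singleton.1 hb)) hne
  · exact fun h => absurd (Finset.mem_attach _ _) h

theorem diff_one_single {w : Mingens I} (hr : ∀ u, u ≠ w → r u w) {u : Mingens I} (hu : u ≠ w)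
    (c : MvPolynomial V 𝕜) :
    diff r 1 (Finsupp.single (edgeCrit hr hu) c) =
      Finsupp.single (vertexCrit r w) (c * MvPolynomial.monomial (u.1 ⊔ w.1 - w.1) 1) -
        Finsupp.single (vertexCrit r u) (c * MvPolynomial.monomial (u.1 ⊔ w.1 - u.1) 1) := by
  classical
  have hmu : u ∈ (edgeCrit hr hu).1 := by rw [edgeCrit_val]; simp
  have hmw : w ∈ (edgeCrit hr hu).1 := by rw [edgeCrit_val]; simp
  have hlcm : lcmOf (edgeCrit hr hu).1 = u.1 ⊔ w.1 := by
    simp [edgeCrit_val, lcmOf, Finset.sup_insert]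
  have hfu : facet (edgeCrit hr hu) u hmu = vertexCrit r w := by
    refine Subtype.ext ?_
    change (edgeCrit hr hu).1.erase u = {w}
    rw [edgeCrit_val]
    ext x
    simp only [Finset.mem_erase, Finset.mem_insert, Finset.mem_singleton]
    constructor
    · tauto
    · rintro rfl; exact ⟨hu.symm, Or.inr rfl⟩
  have hfw : facet (edgeCrit hr hu) w hmw = vertexCrit r u := by
    refine Subtype.ext ?_
    change (edgeCrit hr hu).1.erase w = {u}
    rw [edgeCrit_val]
    ext x
    simp only [Finset.mem_erase, Finset.mem_insert, Finset.mem_singleton]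
    constructor
    · tauto
    · rintro rfl; exact ⟨hu, Or.inl rfl⟩
  have hsu : (edgeCrit hr hu).1.filter (fun b => r b u) = ∅ := by
    rw [edgeCrit_val]
    simp [Finset.filter_insert, Finset.filter_singleton, irrefl_of r u, asymm_of r (hr u hu)]
  have hsw : (edgeCrit hr hu).1.filter (fun b => r b w) = {u} := by
    rw [edgeCrit_val]
    simp [Finset.filter_insert, Finset.filter_singleton, irrefl_of r w, hr u hu]
  have hatt : (edgeCrit hr hu).1.attach = {⟨u, hmu⟩, ⟨w, hmw⟩} := by
    ext ⟨x, hx⟩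
    have hx' := hx
    rw [edgeCrit_val, Finset.mem_insert, Finset.mem_singleton] at hx'
    simpa using hx'
  rw [diff_single, hatt, Finset.sum_pair (fun e => hu (congrArg Subtype.val e))]
  simp only [hfu, hfw, hsu, hsw, hlcm]
  simp [vertexCrit, lcmOf, sub_eq_add_neg, smul_add]

/-- The syzygy condition behind exactness in homological degree `1`: if `∑ gₐ a = 0`, then every
monomial of `gᵤ u` is divisible by a second generator, hence by `w`. -/
theorem monomial_dvd_of_diff_zero_eq_zero {w : Mingens I}
    (hw : ∀ u v : Mingens I, u ≠ v → w.1 ≤ u.1 ⊔ v.1) {g : Chain r 1} (hg : diff r 0 g = 0)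
    (u : Mingens I) :
    MvPolynomial.monomial (u.1 ⊔ w.1 - u.1) 1 ∣ g (vertexCrit r u) := by
  classical
  have hsum : ∑ σ ∈ g.support, g σ * MvPolynomial.monomial (lcmOf σ.1) 1 = 0 := by
    have h1 : diff r 0 g = ∑ σ ∈ g.support, diff r 0 (Finsupp.single σ (g σ)) := by
      rw [← map_sum]
      exact congrArg _ (Finsupp.sum_single g).symm
    rw [hg] at h1
    have h2 := DFunLike.congr_fun h1.symm (emptyCrit r)
    rw [Finsupp.finsetSum_apply] at h2
    rw [Finsupp.zero_apply] at h2
    rw [← h2]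
    refine Finset.sum_congr rfl fun σ _ => ?_
    obtain ⟨a, rfl⟩ := exists_eq_vertexCrit σ
    rw [diff_zero_single, Finsupp.single_eq_same]
    simp [vertexCrit, lcmOf]
  rw [← Ideal.mem_span_singleton,
    ← Set.image_singleton (f := fun a => MvPolynomial.monomial a (1 : 𝕜)),
    MvPolynomial.mem_ideal_span_monomial_image]
  intro α hα
  refine ⟨_, rfl, ?_⟩
  by_contra hcon
  rw [MvPolynomial.mem_support_iff] at hα
  apply hα
  have hlcm : ∀ a : Mingens I, lcmOf (vertexCrit r a).1 = a.1 := fun a => by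
    simp [vertexCrit, lcmOf]
  have h1 := congrArg (MvPolynomial.coeff (α + u.1)) hsum
  rw [MvPolynomial.coeff_sum, Finset.sum_eq_single (vertexCrit r u)] at h1
  · simpa [hlcm, MvPolynomial.coeff_mul_monomial] using h1
  · intro σ _ hσ
    obtain ⟨v, rfl⟩ := exists_eq_vertexCrit σ
    rw [hlcm, MvPolynomial.coeff_mul_monomial', if_neg]
    intro hv
    refine hcon (tsub_le_iff_right.2 (sup_le le_add_self ?_))
    exact (hw u v (fun e => hσ (by rw [e]))).trans (sup_le le_add_self hv)
  · intro h
    rw [Finsupp.notMem_support_iff.1 h, zero_mul, MvPolynomial.coeff_zero]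

theorem diff_zero_diff_one {w : Mingens I} (hw : ∀ u v : Mingens I, u ≠ v → w.1 ≤ u.1 ⊔ v.1)
    (hr : ∀ u, u ≠ w → r u w) (f : Chain r 2) : diff r 0 (diff r 1 f) = 0 := by
  induction f using Finsupp.induction_linear with
  | zero => simp
  | add f g hf hg => rw [map_add, map_add, hf, hg, add_zero]
  | single σ c =>
    obtain ⟨u, hu, rfl⟩ := exists_eq_edgeCrit hw hr σ
    rw [diff_one_single, map_sub, diff_zero_single, diff_zero_single, mul_assoc, mul_assoc,
      MvPolynomial.monomial_mul, MvPolynomial.monomial_mul, tsub_add_cancel_of_le le_sup_right,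
      tsub_add_cancel_of_le le_sup_left, sub_self]

theorem diff_one_apply {w : Mingens I} (hw : ∀ u v : Mingens I, u ≠ v → w.1 ≤ u.1 ⊔ v.1)
    (hr : ∀ u, u ≠ w → r u w) (f : Chain r 2) {u : Mingens I} (hu : u ≠ w) :
    diff r 1 f (vertexCrit r u) =
      -(f (edgeCrit hr hu) * MvPolynomial.monomial (u.1 ⊔ w.1 - u.1) 1) := by
  classical
  induction f using Finsupp.induction_linear with
  | zero => simp
  | add f g hf hg => rw [map_add, Finsupp.add_apply, hf, hg, Finsupp.add_apply]; ring
  | single σ c =>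
    obtain ⟨v, hv, rfl⟩ := exists_eq_edgeCrit hw hr σ
    rw [diff_one_single, Finsupp.sub_apply,
      Finsupp.single_eq_of_ne (fun e => hu (vertexCrit_injective e)), zero_sub]
    by_cases huv : v = u
    · subst huv
      simp
    · rw [Finsupp.single_eq_of_ne (fun e => huv (vertexCrit_injective e).symm),
        Finsupp.single_eq_of_ne, zero_mul]
      intro e
      have h1 : u ∈ (edgeCrit hr hu).1 := by rw [edgeCrit_val]; simp
      rw [e, edgeCrit_val] at h1
      simp [hu, Ne.symm huv] at h1

theorem exact_diff_zero_aug (hI : I = Ideal.span (Set.range fun a : Mingens I =>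
      MvPolynomial.monomial a.1 (1 : 𝕜))) :
    Function.Exact (diff r 0) (aug r) := by
  have haug : ∀ f, aug r (Finsupp.single (emptyCrit r) f) = Ideal.Quotient.mk I f := aug_single
  intro y
  have hy : y = Finsupp.single (emptyCrit r) (y (emptyCrit r)) := by
    ext1 σ
    rw [eq_emptyCrit σ, Finsupp.single_eq_same]
  rw [hy, haug, Ideal.Quotient.eq_zero_iff_mem]
  generalize y (emptyCrit r) = f
  constructor
  · intro hf
    rw [hI] at hf
    refine Submodule.span_induction ?_ ?_ ?_ ?_ hf
    · rintro _ ⟨a, rfl⟩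
      exact ⟨Finsupp.single (vertexCrit r a) 1, by rw [diff_zero_single, one_mul]⟩
    · exact ⟨0, by simp⟩
    · rintro p q - - ⟨x, hx⟩ ⟨z, hz⟩
      exact ⟨x + z, by rw [map_add, hx, hz, Finsupp.single_add]⟩
    · rintro c p - ⟨x, hx⟩
      exact ⟨c • x, by rw [map_smul, hx, Finsupp.smul_single]⟩
  · rintro ⟨x, hx⟩
    rw [← Ideal.Quotient.eq_zero_iff_mem, ← haug, ← hx]
    clear hx
    induction x using Finsupp.induction_linear with
    | zero => simp
    | add f g hf hg => rw [map_add, map_add, hf, hg, add_zero]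
    | single σ c =>
      obtain ⟨a, rfl⟩ := exists_eq_vertexCrit σ
      rw [diff_zero_single, haug, Ideal.Quotient.eq_zero_iff_mem]
      exact I.mul_mem_left _ a.2.1

/-- Exactness in homological degree `1`: a cycle minus a suitable boundary is carried by the vertex
`w` alone, hence vanishes. -/
theorem exact_diff_one_diff_zero {w : Mingens I}
    (hw : ∀ u v : Mingens I, u ≠ v → w.1 ≤ u.1 ⊔ v.1) (hr : ∀ u, u ≠ w → r u w) :
    Function.Exact (diff r 1) (diff r 0) := by
  refine fun g => ⟨fun hg => ?_, fun ⟨f, hf⟩ => hf ▸ diff_zero_diff_one hw hr f⟩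
  -- Modulo boundaries, every summand of the cycle `g` is carried by the vertex `w`.
  have key : ∀ σ, ∃ (f : Chain r 2) (c : MvPolynomial V 𝕜),
      Finsupp.single σ (g σ) = diff r 1 f + Finsupp.single (vertexCrit r w) c := by
    intro σ
    obtain ⟨u, rfl⟩ := exists_eq_vertexCrit σ
    by_cases hu : u = w
    · subst hu
      exact ⟨0, g (vertexCrit r u), by simp⟩
    · obtain ⟨h, hh⟩ := monomial_dvd_of_diff_zero_eq_zero hw hg u
      refine ⟨-Finsupp.single (edgeCrit hr hu) h,
        h * MvPolynomial.monomial (u.1 ⊔ w.1 - w.1) 1, ?_⟩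
      rw [map_neg, diff_one_single, hh, mul_comm h (MvPolynomial.monomial (u.1 ⊔ w.1 - u.1) 1)]
      abel
  choose f c hfc using key
  have hsum : g = diff r 1 (∑ σ ∈ g.support, f σ) +
      Finsupp.single (vertexCrit r w) (∑ σ ∈ g.support, c σ) := by
    rw [map_sum, Finsupp.single_finsetSum, ← Finset.sum_add_distrib]
    conv_lhs => rw [← Finsupp.sum_single g]
    exact Finset.sum_congr rfl fun σ _ => hfc σ
  have hc : (∑ σ ∈ g.support, c σ) = 0 := by
    have h1 := congrArg (diff r 0) hsum
    rw [hg, map_add, diff_zero_diff_one hw hr, zero_add, diff_zero_single] at h1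
    have h2 := Finsupp.single_eq_zero.1 h1.symm
    exact (mul_eq_zero.1 h2).resolve_right (by simp)
  rw [hc, Finsupp.single_zero, add_zero] at hsum
  exact ⟨_, hsum.symm⟩

theorem diff_one_injective {w : Mingens I} (hw : ∀ u v : Mingens I, u ≠ v → w.1 ≤ u.1 ⊔ v.1)
    (hr : ∀ u, u ≠ w → r u w) : Function.Injective (diff r 1) := by
  rw [← LinearMap.ker_eq_bot, LinearMap.ker_eq_bot']
  intro f hf
  ext1 σ
  obtain ⟨u, hu, rfl⟩ := exists_eq_edgeCrit hw hr σ
  have := diff_one_apply hw hr f hu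
  rw [hf, Finsupp.zero_apply, eq_comm, neg_eq_zero] at this
  exact (mul_eq_zero.1 this).resolve_right (by simp)

theorem isFreeResolution_of_le_sup (hI : I = Ideal.span (Set.range fun a : Mingens I =>
      MvPolynomial.monomial a.1 (1 : 𝕜))) {w : Mingens I}
    (hw : ∀ u v : Mingens I, u ≠ v → w.1 ≤ u.1 ⊔ v.1) (hr : ∀ u, u ≠ w → r u w) :
    IsFreeResolution (diff r) (aug r) where
  free _ := inferInstance
  surjective y := by
    obtain ⟨f, rfl⟩ := Ideal.Quotient.mk_surjective y
    exact ⟨Finsupp.single (emptyCrit r) f, aug_single f⟩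
  exact_zero := exact_diff_zero_aug hI
  exact_succ
    | 0 => exact_diff_one_diff_zero hw hr
    | 1 => by
      have := isEmpty_crit hw hr 0
      intro y
      rw [map_eq_zero_iff _ (diff_one_injective hw hr)]
      refine ⟨fun hy => ⟨0, by rw [hy, map_zero]⟩, fun ⟨x, hx⟩ => ?_⟩
      rw [← hx, Subsingleton.elim x 0, map_zero]
    | i + 2 => by
      have := isEmpty_crit hw hr i
      intro y
      rw [Subsingleton.elim y 0, map_zero]
      exact ⟨fun _ => ⟨0, map_zero _⟩, fun _ => rfl⟩

theorem monomial_mem_span_X {a : V →₀ ℕ} (ha : a ≠ 0) :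
    MvPolynomial.monomial a (1 : 𝕜) ∈
      Ideal.span (Set.range (MvPolynomial.X : V → MvPolynomial V 𝕜)) := by
  classical
  rw [← Set.image_univ, MvPolynomial.mem_ideal_span_X_image]
  intro m hm
  rw [MvPolynomial.support_monomial, if_neg one_ne_zero, Finset.mem_singleton] at hm
  subst hm
  obtain ⟨v, hv⟩ := DFunLike.ne_iff.1 ha
  exact ⟨v, trivial, hv⟩

theorem isMinimalComplex_of_le_sup (h0 : ∀ a : Mingens I, a.1 ≠ 0) {w : Mingens I}
    (hw : ∀ u v : Mingens I, u ≠ v → w.1 ≤ u.1 ⊔ v.1) (hr : ∀ u, u ≠ w → r u w) :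
    IsMinimalComplex (diff r) := by
  have hsingle : ∀ {i : ℕ} (σ : Crit r i) (c : MvPolynomial V 𝕜) {a : V →₀ ℕ}, a ≠ 0 →
      Finsupp.single σ (c * MvPolynomial.monomial a 1) ∈
        Ideal.span (Set.range (MvPolynomial.X : V → MvPolynomial V 𝕜)) •
          (⊤ : Submodule (MvPolynomial V 𝕜) (Chain r i)) := by
    intro i σ c a ha
    have := Submodule.smul_mem_smul (monomial_mem_span_X (𝕜 := 𝕜) ha)
      (Submodule.mem_top (x := (Finsupp.single σ c : Chain r i)))
    rwa [Finsupp.smul_single, smul_eq_mul, mul_comm] at this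
  have hne : ∀ {u v : Mingens I}, u ≠ v → u.1 ⊔ v.1 - u.1 ≠ 0 := by
    intro u v huv h
    have hvu : v.1 ≤ u.1 := le_sup_right.trans (tsub_eq_zero_iff_le.1 h)
    exact huv (Subtype.ext (le_antisymm (u.2.2 v.2.1 hvu) hvu))
  rintro i _ ⟨x, rfl⟩
  induction x using Finsupp.induction_linear with
  | zero => simp
  | add f g hf hg => rw [map_add]; exact add_mem hf hg
  | single σ c =>
    match i, σ with
    | 0, σ =>
      obtain ⟨a, rfl⟩ := exists_eq_vertexCrit σ
      rw [diff_zero_single]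
      exact hsingle _ _ (h0 a)
    | 1, σ =>
      obtain ⟨u, hu, rfl⟩ := exists_eq_edgeCrit hw hr σ
      rw [diff_one_single]
      exact sub_mem (hsingle _ _ (by rw [sup_comm]; exact hne hu.symm)) (hsingle _ _ (hne hu))
    | i + 2, σ => exact ((isEmpty_crit hw hr i).false σ).elim

end Lyubeznik

/-- Every type has a strict total order in which a given element `w` comes last. -/
theorem exists_isStrictTotalOrder_last {α : Type*} (w : α) :
    ∃ r : α → α → Prop, IsStrictTotalOrder α r ∧ ∀ u, u ≠ w → r u w := by
  let r : α → α → Prop := fun a b => a ≠ w ∧ (b = w ∨ WellOrderingRel a b)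
  have hirrefl : ∀ a, ¬ r a a := by
    rintro a ⟨h1, h2 | h2⟩
    exacts [h1 h2, irrefl_of WellOrderingRel a h2]
  have htrans : ∀ a b c, r a b → r b c → r a c := by
    rintro a b c ⟨h1, h2⟩ ⟨h3, h4⟩
    exact ⟨h1, h4.imp_right (trans_of WellOrderingRel (h2.resolve_left h3))⟩
  have htri : ∀ a b, ¬ r a b → ¬ r b a → a = b := by
    intro a b h1 h2
    by_contra hab
    rcases trichotomous_of WellOrderingRel a b with h | h | h
    · by_cases ha : a = w
      · exact h2 ⟨fun hb => hab (ha.trans hb.symm), Or.inl ha⟩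
      · exact h1 ⟨ha, Or.inr h⟩
    · exact hab h
    · by_cases hb : b = w
      · exact h1 ⟨fun ha => hab (ha.trans hb.symm), Or.inl hb⟩
      · exact h2 ⟨hb, Or.inr h⟩
  exact ⟨r, { irrefl := hirrefl, trans := htrans, trichotomous := htri },
    fun u hu => ⟨hu, Or.inl rfl⟩⟩

/-- A monomial ideal with a generator `w` that divides the least common multiple of any two distinct
generators has a minimal Lyubeznik resolution. With `w` as the least generator, the critical sets
are `∅`, the singletons and the pairs `{u, w}`. -/
theorem hasMinimalLyubeznikResolution_of_le_sup {V 𝕜 : Type*} [Field 𝕜]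
    {I : Ideal (MvPolynomial V 𝕜)} (hI : I = Ideal.span (Set.range fun a : Mingens I =>
      MvPolynomial.monomial a.1 (1 : 𝕜))) (h0 : ∀ a : Mingens I, a.1 ≠ 0) (w : Mingens I)
    (hw : ∀ u v : Mingens I, u ≠ v → w.1 ≤ u.1 ⊔ v.1) : HasMinimalLyubeznikResolution I := by
  obtain ⟨r, hr, hrw⟩ := exists_isStrictTotalOrder_last w
  exact ⟨r, hr, Lyubeznik.isFreeResolution_of_le_sup hI hw hrw,
    Lyubeznik.isMinimalComplex_of_le_sup h0 hw hrw⟩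

/-! ### The edge and the path with three vertices -/

section Sufficiency

open Finsupp

variable {V 𝕜 : Type*} [Field 𝕜] {G : SimpleGraph V}

theorem hasMinimalLyubeznikResolution_edgeIdeal_pow {n : ℕ} (hn : n ≠ 0)
    {w : V →₀ ℕ} (hwG : w ∈ edgeSums G n)
    (hw : ∀ u ∈ edgeSums G n, ∀ v ∈ edgeSums G n, u ≠ v → w ≤ u ⊔ v) :
    HasMinimalLyubeznikResolution (edgeIdeal 𝕜 G ^ n) := by
  refine hasMinimalLyubeznikResolution_of_le_sup ?_ ?_ ⟨w, minimal_edgeIdeal_pow_iff.2 hwG⟩ ?_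
  · conv_lhs => rw [edgeIdeal_pow_eq_span]
    congr 1
    ext p
    constructor
    · rintro ⟨a, ha, rfl⟩
      exact ⟨⟨a, minimal_edgeIdeal_pow_iff.2 ha⟩, rfl⟩
    · rintro ⟨a, rfl⟩
      exact ⟨a.1, minimal_edgeIdeal_pow_iff.1 a.2, rfl⟩
  · intro a ha
    have := degree_of_mem_edgeSums (minimal_edgeIdeal_pow_iff.1 a.2)
    rw [ha, map_zero] at this
    omega
  · exact fun u v huv => hw u.1 (minimal_edgeIdeal_pow_iff.1 u.2) v.1
      (minimal_edgeIdeal_pow_iff.1 v.2) fun e => huv (Subtype.ext e)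

/-- The ideal is principal, generated by `(xy)ⁿ`. -/
theorem hasMinimalLyubeznikResolution_of_iso_pathGraph_two (e : G ≃g SimpleGraph.pathGraph 2)
    {n : ℕ} (hn : n ≠ 0) : HasMinimalLyubeznikResolution (edgeIdeal 𝕜 G ^ n) := by
  have hadj : G.Adj (e.symm 0) (e.symm 1) := by
    rw [e.symm.map_adj_iff, SimpleGraph.pathGraph_adj]
    simp
  have hV : ∀ v, v = e.symm 0 ∨ v = e.symm 1 := fun v => by
    simp only [RelIso.eq_symm_apply]
    generalize e v = i
    fin_cases i <;> simp
  have hall : ∀ u ∈ edgeSums G n, u = n • (single (e.symm 0) 1 + single (e.symm 1) 1) := by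
    intro u hu
    obtain ⟨i, j, rfl, rfl⟩ := exists_nsmul_of_mem_edgeSums (a := e.symm 0) (b := e.symm 1)
      (c := e.symm 0) G.irrefl hu fun v _ => (hV v).imp_right Or.inl
    rw [add_comm (single (e.symm 1) 1), ← add_smul]
  exact hasMinimalLyubeznikResolution_edgeIdeal_pow hn (nsmul_mem_edgeSums n hadj)
    fun u hu v hv huv => absurd ((hall u hu).trans (hall v hv).symm) huv

theorem hasMinimalLyubeznikResolution_of_iso_pathGraph_three
    (e : G ≃g SimpleGraph.pathGraph 3) :
    HasMinimalLyubeznikResolution (edgeIdeal 𝕜 G ^ 2) := by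
  have hxy : G.Adj (e.symm 0) (e.symm 1) := by
    rw [e.symm.map_adj_iff, SimpleGraph.pathGraph_adj]
    simp
  have hyz : G.Adj (e.symm 1) (e.symm 2) := by
    rw [e.symm.map_adj_iff, SimpleGraph.pathGraph_adj]
    simp
  have hxz : ¬ G.Adj (e.symm 0) (e.symm 2) := by
    rw [e.symm.map_adj_iff, SimpleGraph.pathGraph_adj]
    simp
  have hV : ∀ v, v = e.symm 0 ∨ v = e.symm 1 ∨ v = e.symm 2 := fun v => by
    simp only [RelIso.eq_symm_apply]
    generalize e v = i
    fin_cases i <;> simp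
  generalize e.symm 0 = x at *
  generalize e.symm 1 = y at *
  generalize e.symm 2 = z at *
  -- The generators are `(xy)²`, `(xy)(yz)` and `(yz)²`; the second one divides the
  -- least common multiple of the other two.
  have hall : ∀ u ∈ edgeSums G 2, ∃ i j, i + j = 2 ∧
      u = i • (single x 1 + single y 1) + j • (single y 1 + single z 1) :=
    fun u hu => exists_nsmul_of_mem_edgeSums hxz hu fun v _ => hV v
  have hw : ∀ {i j k l : ℕ}, i + j = 2 → k + l = 2 → i ≠ k →
      (1 • (single x 1 + single y 1) + 1 • (single y 1 + single z 1) : V →₀ ℕ) ≤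
        (i • (single x 1 + single y 1) + j • (single y 1 + single z 1)) ⊔
          (k • (single x 1 + single y 1) + l • (single y 1 + single z 1)) := by
    intro i j k l hij hkl hik v
    simp only [Finsupp.sup_apply, Finsupp.add_apply, Finsupp.smul_apply, smul_eq_mul]
    generalize single x 1 v = α
    generalize single y 1 v = β
    generalize single z 1 v = γ
    obtain rfl : j = 2 - i := by omega
    obtain rfl : l = 2 - k := by omega
    have hi : i ≤ 2 := by omega
    have hk : k ≤ 2 := by omega
    interval_cases i <;> interval_cases k <;> omega
  refine hasMinimalLyubeznikResolution_edgeIdeal_pow two_ne_zero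
    (add_mem_edgeSums (nsmul_mem_edgeSums 1 hxy) hyz) ?_
  intro u hu v hv huv
  obtain ⟨i, j, hij, rfl⟩ := hall u hu
  obtain ⟨k, l, hkl, rfl⟩ := hall v hv
  have := hw hij hkl (by rintro rfl; exact huv (by rw [show j = l by omega]))
  rwa [one_smul ℕ (single y 1 + single z 1)] at this

end Sufficiency

/-! ### The classification -/

theorem mainTheorem3 {V : Type*} [Finite V] (𝕜 : Type*) [Field 𝕜] (G : SimpleGraph V)
    (hG : G.Connected) (hE : G.edgeSet.Nonempty) (n : ℕ) (hn : 2 ≤ n) :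
    HasMinimalLyubeznikResolution (edgeIdeal 𝕜 G ^ n) ↔
      Nonempty (G ≃g SimpleGraph.pathGraph 2) ∨
        (n = 2 ∧ Nonempty (G ≃g SimpleGraph.pathGraph 3)) := by
  refine ⟨pathGraph_of_hasMinimalLyubeznikResolution hG hE hn, ?_⟩
  rintro (⟨⟨e⟩⟩ | ⟨rfl, ⟨e⟩⟩)
  · exact hasMinimalLyubeznikResolution_of_iso_pathGraph_two e (by omega)
  · exact hasMinimalLyubeznikResolution_of_iso_pathGraph_three e
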